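/- Conventions. A continuum is a compact, connected, metrizable space. An arc is a space homeomorphic to $[0,1]$; its endpoints are the points corresponding to $0$ and $1$. A topological graph is a metrizable space that is the union of a finite collection of arcs (edges), any two different ones of which intersect only at points that are endpoints of both. A map $\phi\colon X\to Y$ is monotone if $\phi^{-1}(y)$ is connected and nonempty for every $y\in Y$. A set $S$ is arcwise connected if any two distinct points of $S$ are the endpoints of an arc contained in $S$. A continuum $X$ is a tranched graph if there are a topological graph $Y$ and a continuous monotone map $\phi\colon X\to Y$ such that $\phi^{-1}(D)$ is dense in $X$, where $D=\{y\in Y:\phi^{-1}(y)\text{ is a single point}\}$. A map $f\colon X\to X$ is topologically mixing if for all nonempty open sets $U,V\subset X$ there is $N\in\mathbb{N}$ such that $f^n(U)\cap V\neq\emptyset$ for all $n>N$. Theorem (existence of mixing maps). Let $X$ be a tranched graph, and let $Y$ be a topological graph and $\phi\colon X\to Y$ a continuous monotone map as in the definition of a tranched graph. Assume that the set $\{x\in X:\phi^{-1}(\phi(x))=\{x\}\}$ is arcwise connected. Then there exists a continuous topologically mixing map $f\colon X\to X$. -/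

import Mathlib

open Set Topology

/-- A continuum: a compact, connected (in particular nonempty), metrizable space. -/
structure IsContinuum (X : Type*) [TopologicalSpace X] : Prop where
  compact : CompactSpace X
  connected : ConnectedSpace X
  metrizable : TopologicalSpace.MetrizableSpace X

/-- `A` is an arc in `X` with endpoints `a` and `b`: the image of the unit interval under a
topological embedding that sends `0` to `a` and `1` to `b`. -/
def IsArcBetween {X : Type*} [TopologicalSpace X] (A : Set X) (a b : X) : Prop :=
  ∃ γ : unitInterval → X, IsEmbedding γ ∧ range γ = A ∧ γ 0 = a ∧ γ 1 = b

/-- Arcwise connected sets: any two distinct points of `S` are the endpoints of an arc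
contained in `S`. -/
def IsArcwiseConnected {X : Type*} [TopologicalSpace X] (S : Set X) : Prop :=
  ∀ a ∈ S, ∀ b ∈ S, a ≠ b → ∃ A : Set X, IsArcBetween A a b ∧ A ⊆ S

/-- A topological graph: a metrizable space that is the union of finitely many arcs (edges),
two different ones of which meet only at points that are endpoints of both. Such a space is
compact; connectedness is not part of this definition. -/
def IsTopologicalGraph (Y : Type*) [TopologicalSpace Y] : Prop :=
  TopologicalSpace.MetrizableSpace Y ∧
    ∃ (n : ℕ) (e : Fin n → Set Y) (a b : Fin n → Y),
      (∀ i, IsArcBetween (e i) (a i) (b i)) ∧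
      (⋃ i, e i) = univ ∧
      ∀ i j, i ≠ j → e i ∩ e j ⊆ {a i, b i} ∩ {a j, b j}

/-- Monotone maps in the sense of continuum theory: every fiber is connected (and nonempty). -/
def IsMonotoneMap {X Y : Type*} [TopologicalSpace X] (φ : X → Y) : Prop :=
  ∀ y : Y, IsConnected (φ ⁻¹' {y})

/-- The set `D` of points of `Y` whose fiber is degenerate, i.e. a single point. -/
def degenerateValues {X Y : Type*} (φ : X → Y) : Set Y :=
  {y | ∃ x, φ ⁻¹' {y} = {x}}

/-- `φ : X → Y` exhibits the continuum `X` as a tranched graph over the topological graph `Y`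
(and a tranched graph is a continuum for which such `Y` and `φ` exist). -/
structure IsTranchedGraphMap {X Y : Type*} [TopologicalSpace X] [TopologicalSpace Y]
    (φ : X → Y) : Prop where
  continuum : IsContinuum X
  graph : IsTopologicalGraph Y
  continuous : Continuous φ
  monotone : IsMonotoneMap φ
  dense : Dense (φ ⁻¹' degenerateValues φ)

/-- Topological mixing: for all nonempty open `U`, `V`, all sufficiently late iterates of `U`
meet `V`. -/
def IsTopologicallyMixing {X : Type*} [TopologicalSpace X] (f : X → X) : Prop :=
  ∀ U V : Set X, IsOpen U → IsOpen V → U.Nonempty → V.Nonempty →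
    ∃ N : ℕ, ∀ n : ℕ, N < n → ((f^[n] '' U) ∩ V).Nonempty

/-! Let `D` be the set of degenerate values. It is dense in `Y`, and connected as the image of an
arcwise connected set, so it misses at most one interior point of each edge
(`IsEdgeSystem.exists_exceptional`). After subdivision, each of finitely many edges lies in `D`
except perhaps for its final endpoint. Since `φ` is closed, its section `ψ` is continuous on `D`,
and each edge lifts to a path in `X` on `[0, 1)`, which may oscillate at the far end. Cut each lift
into countably many arcs `E (i, k)` whose diameters tend to zero as `k → ∞`. Their interiors are
open in `X` and their union is dense.

The map is the identity off the interiors of these arcs. On `E (i, k)` it follows a path `w (i, k)`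
with the same endpoints, which covers the arc itself and its neighbours `k - 1` and `k + 1`; for `k
= 0` it covers instead of a predecessor all first arcs `E (j, 0)`, which are reachable because `D`
is connected. For large `k` the path stays near its arc, which gives continuity
(`continuous_arcMap`). Each `w` runs through four nonshrinking paths at quadruple speed, so it
stretches by 2 (`stretches_two_of_quarters`). Hence iterates of a small piece eventually cover a
whole arc, then any prescribed arc, and keep covering it (`isTopologicallyMixing_arcMap`). -/

/-- Every subinterval of `[0, 1]` is sent by `p` onto a set that contains either a whole arc of the
family `E`, or a piece of such an arc that is at least `c` times as long. -/
def Stretches {X ι : Type*} (E : ι → ℝ → X) (c : ℝ) (p : ℝ → X) : Prop :=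
  ∀ a b : ℝ, 0 ≤ a → a < b → b ≤ 1 → (∃ j, E j '' Icc 0 1 ⊆ p '' Icc a b) ∨
    ∃ j a' b', 0 ≤ a' ∧ b' ≤ 1 ∧ c * (b - a) ≤ b' - a' ∧ E j '' Icc a' b' ⊆ p '' Icc a b

/-- Concatenation of two paths parametrized by `[0, 1]`. -/
noncomputable def concat {X : Type*} (p q : ℝ → X) : ℝ → X :=
  fun t => if t ≤ 1 / 2 then p (2 * t) else q (2 * t - 1)

/-- The reversed path. -/
def rev {X : Type*} (p : ℝ → X) : ℝ → X := fun t => p (1 - t)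

/-- A path from `x` to `y` that does not shrink intervals relative to the family `E`. -/
structure IsRoute {X ι : Type*} [TopologicalSpace X] (E : ι → ℝ → X) (p : ℝ → X) (x y : X) :
    Prop where
  continuousOn : ContinuousOn p (Icc 0 1)
  source : p 0 = x
  target : p 1 = y
  stretches : Stretches E 1 p

/-! ### Stretching estimates for concatenated paths -/

section Concat

variable {X ι : Type*} {E : ι → ℝ → X} {p q : ℝ → X}

lemma concat_of_le {t : ℝ} (ht : t ≤ 1 / 2) : concat p q t = p (2 * t) := if_pos ht

lemma concat_of_ge (h : p 1 = q 0) {t : ℝ} (ht : 1 / 2 ≤ t) : concat p q t = q (2 * t - 1) := by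
  rcases ht.eq_or_lt with rfl | ht
  · rw [concat_of_le le_rfl]; norm_num [h]
  · exact if_neg (not_le.mpr ht)

lemma image_left_subset_concat {a b : ℝ} (hb : b ≤ 1 / 2) :
    p '' Icc (2 * a) (2 * b) ⊆ concat p q '' Icc a b := by
  rintro _ ⟨t, ⟨h1, h2⟩, rfl⟩
  refine ⟨t / 2, ⟨by linarith, by linarith⟩, ?_⟩
  rw [concat_of_le (by linarith)]; congr 1; ring

lemma image_right_subset_concat (h : p 1 = q 0) {a b : ℝ} (ha : 1 / 2 ≤ a) :
    q '' Icc (2 * a - 1) (2 * b - 1) ⊆ concat p q '' Icc a b := by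
  rintro _ ⟨t, ⟨h1, h2⟩, rfl⟩
  refine ⟨(t + 1) / 2, ⟨by linarith, by linarith⟩, ?_⟩
  rw [concat_of_ge h (by linarith)]; congr 1; ring

lemma range_left_subset_concat : p '' Icc 0 1 ⊆ concat p q '' Icc 0 1 := by
  have := (image_left_subset_concat (p := p) (q := q) (a := 0) (b := 1 / 2) le_rfl).trans
    (image_mono (Icc_subset_Icc_right (by norm_num : (1 / 2 : ℝ) ≤ 1)))
  simpa using this

lemma range_right_subset_concat (h : p 1 = q 0) : q '' Icc 0 1 ⊆ concat p q '' Icc 0 1 := by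
  have := (image_right_subset_concat (p := p) (q := q) h (a := 1 / 2) (b := 1) le_rfl).trans
    (image_mono (Icc_subset_Icc_left (by norm_num : (0 : ℝ) ≤ 1 / 2)))
  norm_num at this
  simpa using this

lemma concat_range_subset (h : p 1 = q 0) :
    concat p q '' Icc 0 1 ⊆ p '' Icc 0 1 ∪ q '' Icc 0 1 := by
  rintro _ ⟨t, ⟨h1, h2⟩, rfl⟩
  rcases le_total t (1 / 2) with ht | ht
  · exact Or.inl ⟨2 * t, ⟨by linarith, by linarith⟩, (concat_of_le ht).symm⟩
  · exact Or.inr ⟨2 * t - 1, ⟨by linarith, by linarith⟩, (concat_of_ge h ht).symm⟩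

lemma rev_image (a b : ℝ) : rev p '' Icc a b = p '' Icc (1 - b) (1 - a) := by
  have : rev p = p ∘ fun t => 1 - t := rfl
  rw [this, image_comp, image_const_sub_Icc]

lemma rev_range : rev p '' Icc 0 1 = p '' Icc 0 1 := by rw [rev_image]; norm_num

/-- A stretching estimate on a subinterval gives one on the whole interval. -/
lemma Stretches.of_sub {r : ℝ → X} {c a b a₁ b₁ a₂ b₂ K : ℝ} (hq : Stretches E 1 q)
    (h0 : 0 ≤ a₂) (hlt : a₂ < b₂) (h1 : b₂ ≤ 1)
    (hsub : q '' Icc a₂ b₂ ⊆ r '' Icc a₁ b₁) (ha : a ≤ a₁) (hb : b₁ ≤ b)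
    (hK : K ≤ b₂ - a₂) (hc : c * (b - a) ≤ K ∨ 1 ≤ K) :
    (∃ j, E j '' Icc 0 1 ⊆ r '' Icc a b) ∨
    ∃ j a' b', 0 ≤ a' ∧ b' ≤ 1 ∧ c * (b - a) ≤ b' - a' ∧ E j '' Icc a' b' ⊆ r '' Icc a b := by
  have hsub' := hsub.trans (image_mono (f := r) (Icc_subset_Icc ha hb))
  rcases hq a₂ b₂ h0 hlt h1 with ⟨j, hj⟩ | ⟨j, a', b', h0', h1', hl, hj⟩
  · exact Or.inl ⟨j, hj.trans hsub'⟩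
  · rcases hc with hc | hc
    · exact Or.inr ⟨j, a', b', h0', h1', by linarith, hj.trans hsub'⟩
    -- A piece of length at least 1 inside `[0, 1]` is the whole arc.
    · obtain rfl : a' = 0 := by linarith
      obtain rfl : b' = 1 := by linarith
      exact Or.inl ⟨j, hj.trans hsub'⟩

/-- Doubling the speed pays for the loss when an interval straddles the midpoint and only its longer
part is kept. -/
lemma Stretches.concat (hp : Stretches E 1 p) (hq : Stretches E 1 q) (h : p 1 = q 0) :
    Stretches E 1 (concat p q) := by
  intro a b ha hab hb
  rcases le_total b (1 / 2) with hb' | hb'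
  · exact hp.of_sub (by linarith) (by linarith) (by linarith) (image_left_subset_concat hb')
      le_rfl le_rfl le_rfl (Or.inl (by linarith))
  rcases le_total (1 / 2) a with ha' | ha'
  · exact hq.of_sub (by linarith) (by linarith) (by linarith) (image_right_subset_concat h ha')
      le_rfl le_rfl le_rfl (Or.inl (by linarith))
  rcases le_total (b - 1 / 2) (1 / 2 - a) with hl | hl
  · exact hp.of_sub (by linarith) (by linarith) (by linarith) (image_left_subset_concat le_rfl)
      le_rfl hb' le_rfl (Or.inl (by linarith))
  · exact hq.of_sub (by linarith) (by linarith) (by linarith) (image_right_subset_concat h le_rfl)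
      ha' le_rfl le_rfl (Or.inl (by linarith))

/-- Running through four paths at quadruple speed stretches by the factor two. -/
lemma stretches_two_of_quarters {r : ℝ → X} (P : ℕ → ℝ → X) (hP : ∀ k : ℕ, k < 4 → Stretches E 1 (P k))
    (hr : ∀ k : ℕ, k < 4 → ∀ t ∈ Icc (0 : ℝ) 1, r ((t + k) / 4) = P k t) : Stretches E 2 r := by
  have key : ∀ k : ℕ, k < 4 → ∀ a b : ℝ, (k : ℝ) / 4 ≤ a → b ≤ (k + 1) / 4 →
      P k '' Icc (4 * a - k) (4 * b - k) ⊆ r '' Icc a b := by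
    rintro k hk a b ha hb _ ⟨t, ⟨h1, h2⟩, rfl⟩
    exact ⟨(t + k) / 4, ⟨by linarith, by linarith⟩, hr k hk t ⟨by linarith, by linarith⟩⟩
  intro a b ha hab hb
  -- `k` is the quarter containing `a`. An interval meeting only two quarters has at least half its
  -- length in one of them, and speed 4 leaves a factor 2.
  set k := ⌊4 * a⌋₊ with hk
  have hk1 : (k : ℝ) ≤ 4 * a := Nat.floor_le (by linarith)
  have hk2 : 4 * a < k + 1 := Nat.lt_floor_add_one _
  have hk4 : k < 4 := by
    have : (k : ℝ) < 4 := by linarith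
    exact_mod_cast this
  rcases le_total b ((k + 1) / 4) with h1 | h1
  · exact (hP k hk4).of_sub (by linarith) (by linarith) (by linarith)
      (key k hk4 a b (by linarith) h1) le_rfl le_rfl le_rfl (Or.inl (by linarith))
  rcases le_total (b - (k + 1) / 4) ((k + 1) / 4 - a) with h2 | h2
  · exact (hP k hk4).of_sub (by linarith) (by linarith) (by linarith)
      (key k hk4 a _ (by linarith) le_rfl) le_rfl h1 le_rfl (Or.inl (by linarith))
  have hk5 : k + 1 < 4 := by
    have : ((k + 1 : ℕ) : ℝ) < 4 := by push_cast; linarith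
    exact_mod_cast this
  rcases le_total b ((k + 2) / 4) with h3 | h3
  · exact (hP (k + 1) hk5).of_sub (by push_cast; linarith) (by linarith)
      (by push_cast; linarith) (key (k + 1) hk5 ((k + 1) / 4) b (by push_cast; linarith)
      (by push_cast; linarith)) (by linarith) le_rfl le_rfl (Or.inl (by linarith))
  -- Here quarter `k + 1` lies entirely in the interval, so a whole arc is covered, whatever the
  -- length of the interval.
  · exact (hP (k + 1) hk5).of_sub (by push_cast; linarith) (by linarith)
      (by push_cast; linarith) (key (k + 1) hk5 ((k + 1) / 4) ((k + 2) / 4) (by push_cast; linarith)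
      (by push_cast; linarith)) (by linarith) h3 le_rfl (Or.inr (by linarith))

end Concat

/-! ### Routes and their composition -/

section Routes

variable {X ι : Type*} [TopologicalSpace X] {E : ι → ℝ → X} {p q : ℝ → X} {x y z : X}

lemma ContinuousOn.concat (hp : ContinuousOn p (Icc 0 1)) (hq : ContinuousOn q (Icc 0 1))
    (h : p 1 = q 0) : ContinuousOn (concat p q) (Icc 0 1) := by
  have h1 : ContinuousOn (_root_.concat p q) (Icc 0 (1 / 2)) := by
    refine (hp.comp (f := fun t : ℝ => 2 * t) (s := Icc 0 (1 / 2)) (by fun_prop) ?_).congr ?_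
    · rintro t ⟨h1, h2⟩; exact ⟨by linarith, by linarith⟩
    · rintro t ⟨h1, h2⟩; exact concat_of_le h2
  have h2 : ContinuousOn (_root_.concat p q) (Icc (1 / 2) 1) := by
    refine (hq.comp (f := fun t : ℝ => 2 * t - 1) (s := Icc (1 / 2) 1) (by fun_prop) ?_).congr ?_
    · rintro t ⟨h1, h2⟩; exact ⟨by linarith, by linarith⟩
    · rintro t ⟨h1, h2⟩; exact concat_of_ge h h1
  have := h1.union_of_isClosed h2 isClosed_Icc isClosed_Icc
  rwa [Icc_union_Icc_eq_Icc (by norm_num) (by norm_num)] at this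

lemma IsRoute.concat (hp : IsRoute E p x y) (hq : IsRoute E q y z) :
    IsRoute E (concat p q) x z where
  continuousOn := hp.continuousOn.concat hq.continuousOn (hp.target.trans hq.source.symm)
  source := by rw [concat_of_le (by norm_num)]; simpa using hp.source
  target := by
    rw [concat_of_ge (hp.target.trans hq.source.symm) (by norm_num)]; norm_num [hq.target]
  stretches := hp.stretches.concat hq.stretches (hp.target.trans hq.source.symm)

lemma IsRoute.rev (hp : IsRoute E p x y) : IsRoute E (rev p) y x where
  continuousOn := hp.continuousOn.comp (by fun_prop)
    (by rintro t ⟨h1, h2⟩; exact ⟨by linarith, by linarith⟩)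
  source := by simp [_root_.rev, hp.target]
  target := by simp [_root_.rev, hp.source]
  stretches := by
    intro a b ha hab hb
    rw [rev_image]
    have := hp.stretches (1 - b) (1 - a) (by linarith) (by linarith) (by linarith)
    rwa [show 1 - a - (1 - b) = b - a by ring] at this

lemma isRoute_self (i : ι) (hE : ContinuousOn (E i) (Icc 0 1)) :
    IsRoute E (E i) (E i 0) (E i 1) :=
  ⟨hE, rfl, rfl, fun a b ha _ hb => Or.inr ⟨i, a, b, ha, hb, by linarith, le_rfl⟩⟩

lemma IsRoute.stretches_two {p₀ p₁ p₂ p₃ : ℝ → X} {x₀ x₁ x₂ x₃ x₄ : X}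
    (h₀ : IsRoute E p₀ x₀ x₁) (h₁ : IsRoute E p₁ x₁ x₂) (h₂ : IsRoute E p₂ x₂ x₃)
    (h₃ : IsRoute E p₃ x₃ x₄) :
    Stretches E 2 (_root_.concat (_root_.concat p₀ p₁) (_root_.concat p₂ p₃)) := by
  have e₁ := h₀.target.trans h₁.source.symm
  have e₃ := h₂.target.trans h₃.source.symm
  have e₂ := (h₀.concat h₁).target.trans (h₂.concat h₃).source.symm
  refine stretches_two_of_quarters (fun k => match k with | 0 => p₀ | 1 => p₁ | 2 => p₂ | _ => p₃)
    ?_ ?_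
  · intro k hk
    interval_cases k
    exacts [h₀.stretches, h₁.stretches, h₂.stretches, h₃.stretches]
  · rintro k hk t ⟨ht0, ht1⟩
    interval_cases k <;> push_cast
    · rw [concat_of_le (by linarith), concat_of_le (by linarith)]; congr 1; ring
    · rw [concat_of_le (by linarith), concat_of_ge e₁ (by linarith)]; congr 1; ring
    · rw [concat_of_ge e₂ (by linarith), concat_of_le (by linarith)]; congr 1; ring
    · rw [concat_of_ge e₂ (by linarith), concat_of_ge e₃ (by linarith)]; congr 1; ring

end Routes

/-! ### Continuity and mixing of the map defined by arcs -/

section Mixing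

variable {X ι : Type*} {E w : ι → ℝ → X}

open Classical in
/-- The map that runs along `w i` on the interior of the arc `E i`, and is the identity elsewhere. -/
noncomputable def arcMap (E w : ι → ℝ → X) (x : X) : X :=
  if h : ∃ p : ι × ℝ, p.2 ∈ Ioo (0 : ℝ) 1 ∧ E p.1 p.2 = x then w h.choose.1 h.choose.2 else x

lemma arcMap_of_forall_notMem {x : X} (hx : ∀ i, x ∉ E i '' Ioo 0 1) : arcMap E w x = x := by
  refine dif_neg ?_
  rintro ⟨⟨i, s⟩, hs, h⟩
  exact hx i ⟨s, hs, h⟩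

lemma arcMap_apply
    (hinj : ∀ i j, ∀ s ∈ Ioo (0 : ℝ) 1, ∀ t ∈ Icc (0 : ℝ) 1, E i s = E j t → i = j ∧ s = t)
    (hw0 : ∀ i, w i 0 = E i 0) (hw1 : ∀ i, w i 1 = E i 1) (i : ι) {s : ℝ}
    (hs : s ∈ Icc (0 : ℝ) 1) : arcMap E w (E i s) = w i s := by
  by_cases hs' : s ∈ Ioo (0 : ℝ) 1
  · have h : ∃ p : ι × ℝ, p.2 ∈ Ioo (0 : ℝ) 1 ∧ E p.1 p.2 = E i s := ⟨(i, s), hs', rfl⟩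
    obtain ⟨h1, h2⟩ := hinj _ _ _ h.choose_spec.1 _ hs h.choose_spec.2
    rw [arcMap, dif_pos h, h1, h2]
  · have hend : s = 0 ∨ s = 1 := by
      rcases hs.1.eq_or_lt with h | h
      · exact Or.inl h.symm
      · exact Or.inr (le_antisymm hs.2 (not_lt.mp fun h' => hs' ⟨h, h'⟩))
    rw [arcMap_of_forall_notMem]
    · rcases hend with rfl | rfl
      · exact (hw0 i).symm
      · exact (hw1 i).symm
    · rintro j ⟨t, ht, h⟩
      exact hs' ((hinj j i t ht s hs h).2 ▸ ht)

lemma arcMap_image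
    (hinj : ∀ i j, ∀ s ∈ Ioo (0 : ℝ) 1, ∀ t ∈ Icc (0 : ℝ) 1, E i s = E j t → i = j ∧ s = t)
    (hw0 : ∀ i, w i 0 = E i 0) (hw1 : ∀ i, w i 1 = E i 1) (i : ι) {a b : ℝ}
    (ha : 0 ≤ a) (hb : b ≤ 1) : arcMap E w '' (E i '' Icc a b) = w i '' Icc a b := by
  rw [image_image]
  exact image_congr fun s hs => arcMap_apply hinj hw0 hw1 i ⟨ha.trans hs.1, hs.2.trans hb⟩

lemma continuous_arcMap [MetricSpace X] (hE : ∀ i, ContinuousOn (E i) (Icc 0 1))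
    (hinj : ∀ i j, ∀ s ∈ Ioo (0 : ℝ) 1, ∀ t ∈ Icc (0 : ℝ) 1, E i s = E j t → i = j ∧ s = t)
    (hopen : ∀ i, IsOpen (E i '' Ioo 0 1))
    (hw : ∀ i, ContinuousOn (w i) (Icc 0 1))
    (hw0 : ∀ i, w i 0 = E i 0) (hw1 : ∀ i, w i 1 = E i 1)
    (hsmall : ∀ ε > 0, {i | ∃ s ∈ Icc (0 : ℝ) 1, ε ≤ dist (w i s) (E i s)}.Finite) :
    Continuous (arcMap E w) := by
  have hclosed : ∀ i, IsClosed (E i '' Icc 0 1) := fun i =>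
    (isCompact_Icc.image_of_continuousOn (hE i)).isClosed
  -- By compactness `E i` sends closed sets of parameters to closed sets, so continuity of `w i`
  -- descends to the arc even if the arc closes up at its endpoints.
  have hon : ∀ i, ContinuousOn (arcMap E w) (E i '' Icc 0 1) := by
    intro i
    rw [continuousOn_iff_isClosed]
    intro C hC
    refine ⟨E i '' (Icc 0 1 ∩ w i ⁻¹' C), ?_, ?_⟩
    · have h1 : IsClosed (Icc 0 1 ∩ w i ⁻¹' C) := (hw i).preimage_isClosed_of_isClosed isClosed_Icc hC
      exact ((isCompact_Icc.of_isClosed_subset h1 inter_subset_left).image_of_continuousOn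
        ((hE i).mono inter_subset_left)).isClosed
    · ext x
      constructor
      · rintro ⟨h1, s, hs, rfl⟩
        rw [mem_preimage, arcMap_apply hinj hw0 hw1 i hs] at h1
        exact ⟨⟨s, ⟨hs, h1⟩, rfl⟩, s, hs, rfl⟩
      · rintro ⟨⟨s, ⟨hs, h1⟩, rfl⟩, h2⟩
        refine ⟨?_, h2⟩
        rwa [mem_preimage, arcMap_apply hinj hw0 hw1 i hs]
  rw [continuous_iff_continuousAt]
  intro x
  by_cases hx : ∃ i, x ∈ E i '' Ioo 0 1
  · obtain ⟨i, hi⟩ := hx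
    exact (hon i).continuousAt
      (Filter.mem_of_superset ((hopen i).mem_nhds hi) (image_mono Ioo_subset_Icc_self))
  push Not at hx
  have hfx : arcMap E w x = x := arcMap_of_forall_notMem hx
  rw [ContinuousAt, hfx, Metric.tendsto_nhds]
  intro ε hε
  have hfin := hsmall (ε / 2) (by positivity)
  -- Near a fixed point, only finitely many arcs have large displacement; each is handled by
  -- continuity on that closed arc, or avoided if it misses `x`.
  have hF : ∀ᶠ y in 𝓝 x, ∀ i ∈ {i | ∃ s ∈ Icc (0 : ℝ) 1, ε / 2 ≤ dist (w i s) (E i s)},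
      y ∈ E i '' Icc 0 1 → dist (arcMap E w y) x < ε := by
    rw [Filter.eventually_all_finite hfin]
    intro i _
    by_cases hxi : x ∈ E i '' Icc 0 1
    · have h1 := Metric.tendsto_nhds.mp (hon i x hxi) ε hε
      rw [hfx] at h1
      exact eventually_nhdsWithin_iff.mp h1
    · filter_upwards [(hclosed i).isOpen_compl.mem_nhds hxi] with y hy h
      exact absurd h hy
  filter_upwards [hF, Metric.ball_mem_nhds x (half_pos hε)] with y hy hyx
  rw [Metric.mem_ball] at hyx
  by_cases hyi : ∃ i, y ∈ E i '' Ioo 0 1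
  · obtain ⟨i, s, hs, rfl⟩ := hyi
    have hs' := Ioo_subset_Icc_self hs
    by_cases hi : ∃ s ∈ Icc (0 : ℝ) 1, ε / 2 ≤ dist (w i s) (E i s)
    · exact hy i hi ⟨s, hs', rfl⟩
    · push Not at hi
      have h1 := hi s hs'
      rw [arcMap_apply hinj hw0 hw1 i hs']
      linarith [dist_triangle (w i s) (E i s) x]
  · push Not at hyi
    rw [arcMap_of_forall_notMem hyi]
    linarith

/-- Expansion yields a whole arc, `htrans` leads from it to any other arc, and `hself` keeps that
arc covered at all later times, which upgrades transitivity to mixing. -/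
theorem isTopologicallyMixing_arcMap [MetricSpace X] (hE : ∀ i, ContinuousOn (E i) (Icc 0 1))
    (hinj : ∀ i j, ∀ s ∈ Ioo (0 : ℝ) 1, ∀ t ∈ Icc (0 : ℝ) 1, E i s = E j t → i = j ∧ s = t)
    (hdense : Dense (⋃ i, E i '' Icc 0 1))
    (hw0 : ∀ i, w i 0 = E i 0) (hw1 : ∀ i, w i 1 = E i 1)
    (hst : ∀ i, Stretches E 2 (w i))
    (hself : ∀ i, E i '' Icc 0 1 ⊆ w i '' Icc 0 1)
    (htrans : ∀ i j, Relation.ReflTransGen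
      (fun i j => E j '' Icc 0 1 ⊆ w i '' Icc 0 1) i j) :
    IsTopologicallyMixing (arcMap E w) := by
  set f := arcMap E w with hf
  have himg : ∀ i {a b : ℝ}, 0 ≤ a → b ≤ 1 → f '' (E i '' Icc a b) = w i '' Icc a b :=
    fun i a b ha hb => arcMap_image hinj hw0 hw1 i ha hb
  have hsucc : ∀ (n : ℕ) (A : Set X), f^[n + 1] '' A = f '' (f^[n] '' A) := by
    intro n A
    rw [Function.iterate_succ', image_comp]
  have hgrow : ∀ i (a b : ℝ), 0 ≤ a → a < b → b ≤ 1 →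
      ∃ n j, E j '' Icc 0 1 ⊆ f^[n] '' (E i '' Icc a b) := by
    intro i a b ha hab hb
    -- As long as no whole arc is covered, the covered piece at least doubles at each step, which
    -- cannot go on inside `[0, 1]`.
    by_contra! hno
    have hlong : ∀ n : ℕ, ∃ j a' b', 0 ≤ a' ∧ b' ≤ 1 ∧ 2 ^ n * (b - a) ≤ b' - a' ∧
        E j '' Icc a' b' ⊆ f^[n] '' (E i '' Icc a b) := by
      intro n
      induction n with
      | zero => exact ⟨i, a, b, ha, hb, by simp, by simp⟩
      | succ n ih =>
        obtain ⟨j, a', b', ha', hb', hl, hsub⟩ := ih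
        have hpos : 0 < (2 : ℝ) ^ n * (b - a) := mul_pos (by positivity) (by linarith)
        have hsub' : w j '' Icc a' b' ⊆ f^[n + 1] '' (E i '' Icc a b) := by
          rw [hsucc, ← himg j ha' hb']
          exact image_mono hsub
        rcases hst j a' b' ha' (by linarith) hb' with ⟨k, hk⟩ | ⟨k, a'', b'', h0, h1, hl', hk⟩
        · exact absurd (hk.trans hsub') (hno (n + 1) k)
        · exact ⟨k, a'', b'', h0, h1, by rw [pow_succ]; linarith, hk.trans hsub'⟩
    obtain ⟨n, hn⟩ := pow_unbounded_of_one_lt (1 / (b - a)) (one_lt_two (α := ℝ))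
    obtain ⟨j, a', b', h0, h1, hl, -⟩ := hlong n
    rw [div_lt_iff₀ (by linarith)] at hn
    linarith
  have hstep : ∀ {i j} {A : Set X} {n : ℕ}, E j '' Icc 0 1 ⊆ w i '' Icc 0 1 →
      E i '' Icc 0 1 ⊆ f^[n] '' A → E j '' Icc 0 1 ⊆ f^[n + 1] '' A := by
    intro i j A n hij hi
    rw [hsucc]
    refine hij.trans ?_
    rw [← himg i le_rfl le_rfl]
    exact image_mono hi
  have hreach : ∀ {i j} {A : Set X} {n : ℕ}, E i '' Icc 0 1 ⊆ f^[n] '' A →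
      ∃ m, E j '' Icc 0 1 ⊆ f^[m] '' A := by
    intro i j A n hi
    induction htrans i j with
    | refl => exact ⟨n, hi⟩
    | tail _ h ih =>
      obtain ⟨m, hm⟩ := ih
      exact ⟨m + 1, hstep h hm⟩
  intro U V hU hV hUne hVne
  obtain ⟨x, hxU, hx⟩ := hdense.inter_open_nonempty U hU hUne
  obtain ⟨i, s, hs, rfl⟩ := mem_iUnion.mp hx
  obtain ⟨y, hyV, hy⟩ := hdense.inter_open_nonempty V hV hVne
  obtain ⟨k, hk⟩ := mem_iUnion.mp hy
  obtain ⟨a, b, ha, hab, hb, hsub⟩ : ∃ a b : ℝ, 0 ≤ a ∧ a < b ∧ b ≤ 1 ∧ E i '' Icc a b ⊆ U := by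
    have h1 : E i ⁻¹' U ∈ 𝓝[Icc 0 1] s := hE i s hs (hU.mem_nhds hxU)
    obtain ⟨δ, hδ, hball⟩ := Metric.mem_nhdsWithin_iff.mp h1
    refine ⟨max 0 (s - δ / 2), min 1 (s + δ / 2), le_max_left _ _, ?_, min_le_left _ _, ?_⟩
    · have := hs.1; have := hs.2
      rcases hs.1.eq_or_lt with h | h <;>
      simp only [lt_min_iff, max_lt_iff] <;> refine ⟨⟨?_, ?_⟩, ?_, ?_⟩ <;> linarith
    · rintro _ ⟨t, ⟨h1, h2⟩, rfl⟩
      rw [max_le_iff] at h1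
      rw [le_min_iff] at h2
      refine hball ⟨?_, h1.1, h2.1⟩
      rw [Metric.mem_ball, Real.dist_eq, abs_lt]
      constructor <;> linarith
  obtain ⟨n, j, hj⟩ := hgrow i a b ha hab hb
  obtain ⟨m, hm⟩ := hreach (j := k) hj
  refine ⟨m, fun l hl => ?_⟩
  have hall : ∀ l, m ≤ l → E k '' Icc 0 1 ⊆ f^[l] '' (E i '' Icc a b) := by
    intro l hl
    induction l, hl using Nat.le_induction with
    | base => exact hm
    | succ l _ ih => exact hstep (hself k) ih
  exact ⟨y, image_mono hsub (hall l hl.le hk), hyV⟩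

end Mixing

/-! ### Edges of the graph and the degenerate values -/

/-- A family of paths `[0, 1] → Y` that covers `Y`, in which interior points of the paths are hit
only once. -/
structure IsEdgeSystem {Y H : Type*} [TopologicalSpace Y] (h : H → ℝ → Y) : Prop where
  continuousOn : ∀ i, ContinuousOn (h i) (Icc 0 1)
  inj : ∀ i j, ∀ s ∈ Ioo (0 : ℝ) 1, ∀ t ∈ Icc (0 : ℝ) 1, h i s = h j t → i = j ∧ s = t
  cover : ∀ y, ∃ i, ∃ s ∈ Icc (0 : ℝ) 1, h i s = y

/-- The two halves of a path cut at the parameter `m`, both starting at the cut. -/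
def splitEdge {Y H : Type*} (h : H → ℝ → Y) (m : H → ℝ) : H × Bool → ℝ → Y
  | (i, false), s => h i (m i * (1 - s))
  | (i, true), s => h i (m i + (1 - m i) * s)

section Edges

variable {Y H : Type*} [TopologicalSpace Y] {h : H → ℝ → Y}

lemma IsTopologicalGraph.exists_isEdgeSystem (hY : IsTopologicalGraph Y) :
    ∃ (n : ℕ) (h : Fin n → ℝ → Y), IsEdgeSystem h := by
  obtain ⟨-, n, e, a, b, harc, hcov, hinter⟩ := hY
  choose γ hγ hrange hγ0 hγ1 using harc
  refine ⟨n, fun i => γ i ∘ projIcc 0 1 zero_le_one, ?_, ?_, ?_⟩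
  · exact fun i => ((hγ i).continuous.comp continuous_projIcc).continuousOn
  · intro i j s hs t ht hst
    have hs' := Ioo_subset_Icc_self hs
    simp only [Function.comp, projIcc_of_mem _ hs', projIcc_of_mem _ ht] at hst
    have hij : i = j := by
      by_contra hne
      have hmem : γ i ⟨s, hs'⟩ ∈ e i ∩ e j :=
        ⟨hrange i ▸ mem_range_self _, hst ▸ hrange j ▸ mem_range_self _⟩
      rcases (hinter i j hne hmem).1 with h1 | h1
      · rw [← hγ0] at h1
        have := congrArg Subtype.val ((hγ i).injective h1)
        exact hs.1.ne' this
      · rw [mem_singleton_iff, ← hγ1] at h1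
        have := congrArg Subtype.val ((hγ i).injective h1)
        exact hs.2.ne this
    subst hij
    exact ⟨rfl, congrArg Subtype.val ((hγ i).injective hst)⟩
  · intro y
    obtain ⟨i, hi⟩ := mem_iUnion.mp (hcov.symm ▸ mem_univ y)
    rw [← hrange] at hi
    obtain ⟨s, rfl⟩ := hi
    exact ⟨i, s, s.2, by simp [projIcc_val]⟩

lemma IsEdgeSystem.split (hh : IsEdgeSystem h) {m : H → ℝ} (hm : ∀ i, m i ∈ Ioo (0 : ℝ) 1) :
    IsEdgeSystem (splitEdge h m) where
  continuousOn := by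
    rintro ⟨i, _ | _⟩ <;> have h1 := (hm i).1 <;> have h2 := (hm i).2
    · refine (hh.continuousOn i).comp (f := fun s : ℝ => m i * (1 - s)) (by fun_prop) ?_
      rintro s ⟨hs0, hs1⟩
      exact ⟨by nlinarith, by nlinarith⟩
    · refine (hh.continuousOn i).comp (f := fun s : ℝ => m i + (1 - m i) * s) (by fun_prop) ?_
      rintro s ⟨hs0, hs1⟩
      exact ⟨by nlinarith, by nlinarith⟩
  inj := by
    rintro ⟨i, _ | _⟩ ⟨j, _ | _⟩ s ⟨hs0, hs1⟩ t ⟨ht0, ht1⟩ hst <;> have h1 := (hm i).1 <;>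
      have h2 := (hm i).2 <;> have h3 := (hm j).1 <;> have h4 := (hm j).2 <;>
      obtain ⟨rfl, he⟩ := hh.inj _ _ _ ⟨by nlinarith, by nlinarith⟩ _
        ⟨by nlinarith, by nlinarith⟩ hst
    · have := mul_left_cancel₀ h1.ne' he
      exact ⟨rfl, by linarith⟩
    · nlinarith
    · nlinarith
    · have := mul_left_cancel₀ (sub_pos.mpr h2).ne' (add_left_cancel he)
      exact ⟨rfl, by linarith⟩
  cover := by
    intro y
    obtain ⟨i, s, ⟨hs0, hs1⟩, rfl⟩ := hh.cover y
    have h1 := (hm i).1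
    have h2 := sub_pos.mpr (hm i).2
    rcases le_total s (m i) with hs | hs
    · have h3 : s / m i ≤ 1 := (div_le_one h1).mpr hs
      have h4 : 0 ≤ s / m i := by positivity
      refine ⟨(i, false), 1 - s / m i, ⟨by linarith, by linarith⟩, ?_⟩
      simp only [splitEdge]
      congr 1; field_simp; ring
    · have h3 : (s - m i) / (1 - m i) ≤ 1 := (div_le_one h2).mpr (by linarith)
      have h4 : 0 ≤ (s - m i) / (1 - m i) := div_nonneg (by linarith) h2.le
      refine ⟨(i, true), (s - m i) / (1 - m i), ⟨h4, h3⟩, ?_⟩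
      simp only [splitEdge]
      congr 1; field_simp; ring

variable [T2Space Y]

lemma IsEdgeSystem.isClosed_image (hh : IsEdgeSystem h) (i : H) {s t : ℝ} (hs : 0 ≤ s)
    (ht : t ≤ 1) : IsClosed (h i '' Icc s t) :=
  (isCompact_Icc.image_of_continuousOn
    ((hh.continuousOn i).mono (Icc_subset_Icc hs ht))).isClosed

variable [Finite H]

lemma IsEdgeSystem.isOpen_image (hh : IsEdgeSystem h) (i : H) {s t : ℝ} (hs : 0 ≤ s)
    (ht : t ≤ 1) : IsOpen (h i '' Ioo s t) := by
  have hcompl : (h i '' Ioo s t)ᶜ =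
      (⋃ j ∈ {j | j ≠ i}, h j '' Icc 0 1) ∪ (h i '' Icc 0 (min s 1) ∪ h i '' Icc (max t 0) 1) := by
    ext y
    constructor
    · intro hy
      obtain ⟨j, r, hr, rfl⟩ := hh.cover y
      by_cases hj : j = i
      · subst hj
        right
        rcases le_or_gt r s with h1 | h1
        · exact Or.inl ⟨r, ⟨hr.1, le_min h1 hr.2⟩, rfl⟩
        · rcases le_or_gt t r with h2 | h2
          · exact Or.inr ⟨r, ⟨max_le h2 hr.1, hr.2⟩, rfl⟩
          · exact absurd ⟨r, ⟨h1, h2⟩, rfl⟩ hy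
      · exact Or.inl (mem_biUnion (show j ∈ {j | j ≠ i} from hj) ⟨r, hr, rfl⟩)
    · rintro hy ⟨r, ⟨hr0, hr1⟩, rfl⟩
      have hr : r ∈ Ioo (0 : ℝ) 1 := ⟨by linarith, by linarith⟩
      rcases hy with hy | ⟨q, ⟨hq0, hq1⟩, hq⟩ | ⟨q, ⟨hq0, hq1⟩, hq⟩
      · obtain ⟨j, hj, q, hq, he⟩ := mem_iUnion₂.mp hy
        exact hj (hh.inj _ _ _ hr _ hq he.symm).1.symm
      · have hq2 := hq1.trans (min_le_left _ _)
        have := (hh.inj _ _ _ hr _ ⟨hq0, hq1.trans (min_le_right _ _)⟩ hq.symm).2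
        linarith
      · have hq2 := (le_max_left _ _).trans hq0
        have := (hh.inj _ _ _ hr _ ⟨(le_max_right _ _).trans hq0, hq1⟩ hq.symm).2
        linarith
  rw [← isClosed_compl_iff, hcompl]
  refine IsClosed.union (Finite.isClosed_biUnion (toFinite _) fun j _ =>
    hh.isClosed_image j le_rfl le_rfl) (IsClosed.union ?_ ?_)
  · exact hh.isClosed_image i le_rfl (min_le_right _ _)
  · exact hh.isClosed_image i (le_max_right _ _) le_rfl

/-- A dense connected set misses at most one interior point of each edge. -/
lemma IsEdgeSystem.exists_exceptional (hh : IsEdgeSystem h) {D : Set Y} (hD : Dense D)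
    (hconn : IsPreconnected D) (i : H) :
    ∃ m ∈ Ioo (0 : ℝ) 1, ∀ s ∈ Ioo (0 : ℝ) 1, s ≠ m → h i s ∈ D := by
  -- If two interior points were missing, the open segment between them would be a proper nonempty
  -- clopen part of `D`.
  have key : ∀ s t : ℝ, 0 < s → s < t → t < 1 → h i s ∉ D → h i t ∈ D := by
    intro s t hs hst ht hsD
    by_contra htD
    have hmid : IsOpen (h i '' Ioo s t) := hh.isOpen_image i hs.le ht.le
    have hlow : IsOpen (h i '' Ioo 0 s) := hh.isOpen_image i le_rfl (hst.trans ht).le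
    obtain ⟨x, hx, hxD⟩ := hD.inter_open_nonempty _ hmid ((nonempty_Ioo.mpr hst).image _)
    obtain ⟨y, hy, hyD⟩ := hD.inter_open_nonempty _ hlow ((nonempty_Ioo.mpr hs).image _)
    have hcl : IsClosed (h i '' Icc s t) := hh.isClosed_image i hs.le ht.le
    have hcov : D ⊆ h i '' Ioo s t ∪ (h i '' Icc s t)ᶜ := by
      intro z hz
      by_cases hz' : z ∈ h i '' Icc s t
      · obtain ⟨r, ⟨hr0, hr1⟩, rfl⟩ := hz'
        refine Or.inl ⟨r, ⟨hr0.lt_of_ne ?_, hr1.lt_of_ne ?_⟩, rfl⟩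
        · rintro rfl; exact hsD hz
        · rintro rfl; exact htD hz
      · exact Or.inr hz'
    have hy' : y ∈ (h i '' Icc s t)ᶜ := by
      obtain ⟨r, ⟨hr0, hr1⟩, rfl⟩ := hy
      rintro ⟨q, ⟨hq0, hq1⟩, hq⟩
      have := (hh.inj _ _ r ⟨hr0, by linarith⟩ q ⟨by linarith, by linarith⟩ hq.symm).2
      linarith
    obtain ⟨z, -, hz1, hz2⟩ := hconn _ _ hmid hcl.isOpen_compl hcov ⟨x, hxD, hx⟩ ⟨y, hyD, hy'⟩
    exact hz2 (image_mono Ioo_subset_Icc_self hz1)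
  by_cases hex : ∃ m ∈ Ioo (0 : ℝ) 1, h i m ∉ D
  · obtain ⟨m, hm, hmD⟩ := hex
    refine ⟨m, hm, fun s hs hne => ?_⟩
    rcases hne.lt_or_gt with h1 | h1
    · by_contra hsD
      exact hmD (key s m hs.1 h1 hm.2 hsD)
    · exact key m s hm.1 h1 hs.2 hmD
  · push Not at hex
    exact ⟨1 / 2, ⟨by norm_num, by norm_num⟩, fun s hs _ => hex s hs⟩

end Edges

/-- A topological graph with a dense connected subset `D` is a finite union of edges that lie in `D`
except possibly for their final endpoints. -/
lemma IsTopologicalGraph.exists_isEdgeSystem_subset {Y : Type*} [TopologicalSpace Y] [T2Space Y]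
    (hY : IsTopologicalGraph Y) {D : Set Y} (hD : Dense D) (hconn : IsPreconnected D) :
    ∃ (H : Type) (_ : Finite H) (h : H → ℝ → Y), IsEdgeSystem h ∧
      ∀ i, ∀ s ∈ Ico (0 : ℝ) 1, h i s ∈ D := by
  obtain ⟨n, g, hg⟩ := hY.exists_isEdgeSystem
  choose m hm hmD using hg.exists_exceptional hD hconn
  have hhalf : (1 / 2 : ℝ) ∈ Ioo (0 : ℝ) 1 := ⟨by norm_num, by norm_num⟩
  have hD' : ∀ i, ∀ s ∈ Ioo (0 : ℝ) 1, splitEdge g m i s ∈ D := by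
    rintro ⟨i, _ | _⟩ s ⟨hs0, hs1⟩ <;> have h1 := (hm i).1 <;> have h2 := (hm i).2
    · exact hmD i _ ⟨by nlinarith, by nlinarith⟩ (by nlinarith)
    · exact hmD i _ ⟨by nlinarith, by nlinarith⟩ (by nlinarith)
  -- The first cut makes exceptional points endpoints. The second cut, at midpoints, makes every
  -- edge start at a point of `D`, with any bad point at parameter 1.
  refine ⟨(Fin n × Bool) × Bool, inferInstance, _, (hg.split hm).split fun _ => hhalf, ?_⟩
  rintro ⟨i, _ | _⟩ s ⟨hs0, hs1⟩
  · exact hD' i _ ⟨by linarith, by linarith⟩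
  · exact hD' i _ ⟨by linarith, by linarith⟩

/-! ### Partitions of half-open paths -/

/-- A path on a half-open interval can be cut into pieces whose diameters tend to zero. -/
lemma exists_fine_partition {X : Type*} [MetricSpace X] {σ : ℝ → X}
    (hσ : ContinuousOn σ (Ico 0 1)) :
    ∃ (t η : ℕ → ℝ), t 0 = 0 ∧ StrictMono t ∧ (∀ k, t k < 1) ∧ (∀ s < 1, ∃ k, s < t k) ∧
      (∀ k, t (k + 1) - t k ≤ 1 / 2) ∧ Filter.Tendsto η Filter.atTop (𝓝 0) ∧
      ∀ k, ∀ r ∈ Icc (t k) (t (k + 1)), ∀ s ∈ Icc (t k) (t (k + 1)), dist (σ r) (σ s) ≤ η k := by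
  have hunif : ∀ j : ℕ, ∃ c > (0 : ℝ), c ≤ 1 / 2 ∧ ∀ x ∈ Icc (0 : ℝ) (1 - 1 / (j + 3)),
      ∀ y ∈ Icc (0 : ℝ) (1 - 1 / (j + 3)), |x - y| ≤ c → dist (σ x) (σ y) ≤ 1 / (j + 1) := by
    intro j
    have hj : (0 : ℝ) < 1 / (j + 3) := by positivity
    have huc := isCompact_Icc.uniformContinuousOn_of_continuous
      (hσ.mono (fun x (hx : x ∈ Icc (0 : ℝ) (1 - 1 / (j + 3))) => ⟨hx.1, by linarith [hx.2]⟩))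
    obtain ⟨δ, hδ, h⟩ := Metric.uniformContinuousOn_iff.mp huc (1 / (j + 1)) (by positivity)
    refine ⟨min (δ / 2) (1 / 2), by positivity, min_le_right _ _, fun x hx y hy hxy => ?_⟩
    exact (h x hx y hy (by
      rw [Real.dist_eq]
      linarith [min_le_left (δ / 2) (1 / 2 : ℝ)])).le
  choose c hc0 hc1 hc using hunif
  -- The 1-Lipschitz map `g` carries `[0, ∞)` onto `[0, 1)`. The points `x k` advance by a modulus
  -- of uniform continuity depending only on `⌊x k⌋₊`, so steps are bounded below on bounded sets
  -- and `x k → ∞`.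
  set g : ℝ → ℝ := fun x => 1 - 1 / (x + 1) with hg
  let x : ℕ → ℝ := fun k => Nat.rec 0 (fun _ y => y + c ⌊y⌋₊) k
  have hx0 : x 0 = 0 := rfl
  have hxs : ∀ k, x (k + 1) = x k + c ⌊x k⌋₊ := fun k => rfl
  have hxm : StrictMono x := strictMono_nat_of_lt_succ fun k => by
    rw [hxs]; linarith [hc0 ⌊x k⌋₊]
  have hxn : ∀ k, 0 ≤ x k := fun k => hx0 ▸ hxm.monotone (Nat.zero_le k)
  have hxtop : Filter.Tendsto x Filter.atTop Filter.atTop := by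
    refine Filter.tendsto_atTop_atTop_of_monotone hxm.monotone ?_
    by_contra! hbdd
    obtain ⟨B, hB⟩ := hbdd
    obtain ⟨d, hd0, hd⟩ : ∃ d > 0, ∀ j ≤ ⌊B⌋₊, d ≤ c j := by
      obtain ⟨j, -, hj⟩ := Finset.exists_min_image (Finset.range (⌊B⌋₊ + 1)) c ⟨0, by simp⟩
      exact ⟨c j, hc0 j, fun l hl => hj l (by simpa using Nat.lt_succ_of_le hl)⟩
    have hlin : ∀ k : ℕ, k * d ≤ x k := by
      intro k
      induction k with
      | zero => simp [hx0]
      | succ k ih =>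
        rw [hxs]; push_cast
        linarith [hd ⌊x k⌋₊ (Nat.floor_mono (hB k).le)]
    obtain ⟨k, hk⟩ := exists_nat_gt (B / d)
    rw [div_lt_iff₀ hd0] at hk
    linarith [hlin k, hB k]
  have hgm : ∀ {u v : ℝ}, 0 ≤ u → u ≤ v → g v - g u ≤ v - u := by
    intro u v hu huv
    have : g v - g u = (v - u) / ((u + 1) * (v + 1)) := by
      have h1 : u + 1 ≠ 0 := by linarith
      have h2 : v + 1 ≠ 0 := by linarith
      simp only [hg]; field_simp; ring
    rw [this]
    exact div_le_self (by linarith) (by nlinarith)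
  have hgs : ∀ {u v : ℝ}, 0 ≤ u → u < v → g u < g v := by
    intro u v hu huv
    have := one_div_lt_one_div_of_lt (show 0 < u + 1 by linarith) (show u + 1 < v + 1 by linarith)
    simp only [hg]; linarith
  refine ⟨fun k => g (x k), fun k => 1 / (⌊x k⌋₊ + 1), by simp [hg, hx0],
    fun k l hkl => hgs (hxn k) (hxm hkl), fun k => ?_, fun s hs => ?_, fun k => ?_, ?_, ?_⟩
  · have : 0 < 1 / (x k + 1) := by have := hxn k; positivity
    simp only [hg]; linarith
  · obtain ⟨k, hk⟩ := (hxtop.eventually_gt_atTop (1 / (1 - s))).exists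
    refine ⟨k, ?_⟩
    have h1 : 0 < 1 - s := by linarith
    rw [div_lt_iff₀ h1] at hk
    have h2 : 1 / (x k + 1) < 1 - s := by
      rw [div_lt_iff₀ (by linarith [hxn k])]; nlinarith
    simp only [hg]; linarith
  · have := hgm (hxn k) (hxm (Nat.lt_succ_self k)).le
    have h1 := hxs k
    linarith [hc1 ⌊x k⌋₊]
  · exact tendsto_one_div_add_atTop_nhds_zero_nat.comp (tendsto_nat_floor_atTop.comp hxtop)
  · have hg0 : g 0 = 0 := by simp [hg]
    intro k
    have h0 : 0 ≤ g (x k) := by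
      rcases (hxn k).eq_or_lt with h | h
      · rw [← h, hg0]
      · exact hg0 ▸ (hgs le_rfl h).le
    have hd := hgm (hxn k) (hxm (Nat.lt_succ_self k)).le
    have h1 := hxs k
    -- A step of at most 1/2 gives `x (k + 1) + 1 ≤ ⌊x k⌋₊ + 3`; hence the 3 in the choice of `c`.
    have htop : g (x (k + 1)) ≤ 1 - 1 / (⌊x k⌋₊ + 3) := by
      have hfl := Nat.lt_floor_add_one (x k)
      have := one_div_le_one_div_of_le (show 0 < x (k + 1) + 1 by linarith [hxn (k + 1)])
        (show x (k + 1) + 1 ≤ (⌊x k⌋₊ : ℝ) + 3 by linarith [hc1 ⌊x k⌋₊])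
      simp only [hg]
      linarith
    intro r hr s hs
    refine hc ⌊x k⌋₊ r ⟨h0.trans hr.1, hr.2.trans htop⟩ s ⟨h0.trans hs.1, hs.2.trans htop⟩ ?_
    rw [abs_le]
    constructor <;> linarith [hr.1, hr.2, hs.1, hs.2]

lemma exists_mem_Ico_of_partition {t : ℕ → ℝ} (ht0 : t 0 = 0) (htop : ∀ s < 1, ∃ k, s < t k)
    {s : ℝ} (hs : s ∈ Ico (0 : ℝ) 1) : ∃ k, s ∈ Ico (t k) (t (k + 1)) := by
  classical
  have hex := htop s hs.2
  have hpos : Nat.find hex ≠ 0 := by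
    intro h0
    have := Nat.find_spec hex
    rw [h0, ht0] at this
    exact absurd hs.1 (not_le.mpr this)
  obtain ⟨k, hk⟩ := Nat.exists_eq_succ_of_ne_zero hpos
  refine ⟨k, not_lt.mp (Nat.find_min hex (by omega)), ?_⟩
  have := Nat.find_spec hex
  rwa [hk] at this

/-- Pieces of length at most 1/2 are rescaled to `[0, 1]`, a gain of at least 2 that pays for an
interval split between two pieces. An interval reaching past the next piece covers it whole. -/
lemma stretches_of_partition {X ι : Type*} {E : ι → ℝ → X} {σ : ℝ → X} {t : ℕ → ℝ}
    (ht0 : t 0 = 0) (hmono : StrictMono t) (htop : ∀ s < 1, ∃ k, s < t k)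
    (hgap : ∀ k, t (k + 1) - t k ≤ 1 / 2) (e : ℕ → ι)
    (hE : ∀ k s, E (e k) s = σ (t k + (t (k + 1) - t k) * s)) : Stretches E 1 σ := by
  have hl : ∀ k, 0 < t (k + 1) - t k := fun k => sub_pos.mpr (hmono (Nat.lt_succ_self k))
  intro a b ha hab hb
  have piece : ∀ k a' b', t k ≤ a' → b' ≤ t (k + 1) → a ≤ a' → b' ≤ b → b - a ≤ 2 * (b' - a') →
      ∃ j c d, 0 ≤ c ∧ d ≤ 1 ∧ 1 * (b - a) ≤ d - c ∧ E j '' Icc c d ⊆ σ '' Icc a b := by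
    intro k a' b' h1 h2 h3 h4 h5
    refine ⟨e k, (a' - t k) / (t (k + 1) - t k), (b' - t k) / (t (k + 1) - t k),
      div_nonneg (by linarith) (hl k).le, (div_le_one (hl k)).mpr (by linarith), ?_, ?_⟩
    · rw [← sub_div, le_div_iff₀ (hl k)]
      nlinarith [hgap k, hl k]
    · rintro _ ⟨s, ⟨hs1, hs2⟩, rfl⟩
      rw [div_le_iff₀ (hl k)] at hs1
      rw [le_div_iff₀ (hl k)] at hs2
      exact ⟨_, ⟨by linarith, by linarith⟩, (hE k s).symm⟩
  obtain ⟨k, hk1, hk2⟩ := exists_mem_Ico_of_partition ht0 htop ⟨ha, hab.trans_le hb⟩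
  rcases le_total b (t (k + 1)) with h1 | h1
  · exact Or.inr (piece k a b hk1 h1 le_rfl le_rfl (by linarith))
  rcases le_total b (t (k + 1 + 1)) with h2 | h2
  · rcases le_total (b - t (k + 1)) (t (k + 1) - a) with h3 | h3
    · exact Or.inr (piece k a (t (k + 1)) hk1 le_rfl le_rfl h1 (by linarith))
    · exact Or.inr (piece (k + 1) (t (k + 1)) b le_rfl h2 hk2.le le_rfl (by linarith))
  · left
    refine ⟨e (k + 1), ?_⟩
    rintro _ ⟨s, ⟨hs1, hs2⟩, rfl⟩
    refine ⟨_, ⟨?_, ?_⟩, (hE (k + 1) s).symm⟩ <;> nlinarith [hl (k + 1)]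

/-! ### Construction of the mixing map -/

/-- A space `X` over a graph `Y`, with a section over a dense connected set that contains the edges
except for their final endpoints, carries a mixing map. -/
theorem exists_mixing_of_isEdgeSystem {X Y H : Type*} [MetricSpace X] [TopologicalSpace Y]
    [T2Space Y] [Finite H] {φ : X → Y} {ψ : Y → X} {D : Set Y} {h : H → ℝ → Y}
    (hφ : Continuous φ) (hφψ : ∀ y, φ (ψ y) = y) (hψφ : ∀ x, φ x ∈ D → ψ (φ x) = x)
    (hψ : ContinuousOn ψ D) (hdense : Dense (φ ⁻¹' D)) (hconn : IsPreconnected D)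
    (hh : IsEdgeSystem h) (hD : ∀ i, ∀ s ∈ Ico (0 : ℝ) 1, h i s ∈ D) :
    ∃ f : X → X, Continuous f ∧ IsTopologicallyMixing f := by
  have hzero : (0 : ℝ) ∈ Icc (0 : ℝ) 1 := ⟨le_rfl, zero_le_one⟩
  have hone : (1 : ℝ) ∈ Icc (0 : ℝ) 1 := ⟨zero_le_one, le_rfl⟩
  set σ : H → ℝ → X := fun i s => ψ (h i s) with hσdef
  have hσ : ∀ i, ContinuousOn (σ i) (Ico 0 1) := fun i =>
    hψ.comp ((hh.continuousOn i).mono Ico_subset_Icc_self) (hD i)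
  have hσ1 : ∀ i, h i 1 ∈ D → ContinuousOn (σ i) (Icc 0 1) := by
    intro i hi
    refine hψ.comp (hh.continuousOn i) fun s hs => ?_
    rcases hs.2.eq_or_lt with rfl | h1
    · exact hi
    · exact hD i s ⟨hs.1, h1⟩
  choose t η ht0 htmono htlt httop htgap hη hdist using fun i => exists_fine_partition (hσ i)
  have hl : ∀ i k, 0 < t i (k + 1) - t i k := fun i k =>
    sub_pos.mpr (htmono i (Nat.lt_succ_self k))
  have htn : ∀ i k, 0 ≤ t i k := fun i k => ht0 i ▸ (htmono i).monotone (Nat.zero_le k)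
  set E : H × ℕ → ℝ → X := fun p s => σ p.1 (t p.1 p.2 + (t p.1 (p.2 + 1) - t p.1 p.2) * s)
    with hEdef
  have hmem : ∀ i k, ∀ s ∈ Icc (0 : ℝ) 1,
      t i k + (t i (k + 1) - t i k) * s ∈ Icc (t i k) (t i (k + 1)) := by
    rintro i k s ⟨h1, h2⟩
    constructor <;> nlinarith [hl i k]
  have hmem' : ∀ i k, ∀ s ∈ Ioo (0 : ℝ) 1,
      t i k + (t i (k + 1) - t i k) * s ∈ Ioo (t i k) (t i (k + 1)) := by
    rintro i k s ⟨h1, h2⟩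
    constructor <;> nlinarith [hl i k]
  have hEc : ∀ p, ContinuousOn (E p) (Icc 0 1) := by
    rintro ⟨i, k⟩
    refine (hσ i).comp (f := fun s => t i k + (t i (k + 1) - t i k) * s) (by fun_prop) ?_
    intro s hs
    have := hmem i k s hs
    exact ⟨(htn i k).trans this.1, this.2.trans_lt (htlt i (k + 1))⟩
  have hE0 : ∀ i k, E (i, k) 0 = σ i (t i k) := fun i k => by simp [hEdef]
  have hE1 : ∀ i k, E (i, k) 1 = σ i (t i (k + 1)) := fun i k => by simp [hEdef]
  have hE01 : ∀ i k, E (i, k) 1 = E (i, k + 1) 0 := fun i k => by rw [hE0, hE1]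
  have hself : ∀ p, IsRoute E (E p) (E p 0) (E p 1) := fun p => isRoute_self p (hEc p)
  have hstart : ∀ i, E (i, 0) 0 = σ i 0 := fun i => by rw [hE0, ht0]
  have hrange : ∀ i k, ∀ x ∈ E (i, k) '' Icc 0 1, ∃ r ∈ Icc (t i k) (t i (k + 1)), σ i r = x := by
    rintro i k _ ⟨s, hs, rfl⟩
    exact ⟨_, hmem i k s hs, rfl⟩
  have hpiece : ∀ i k, ∀ x ∈ E (i, k) '' Icc 0 1, ∀ y ∈ E (i, k) '' Icc 0 1, dist x y ≤ η i k := by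
    intro i k x hx y hy
    obtain ⟨r, hr, rfl⟩ := hrange i k x hx
    obtain ⟨s, hs, rfl⟩ := hrange i k y hy
    exact hdist i k r hr s hs
  have hinj : ∀ p q, ∀ s ∈ Ioo (0 : ℝ) 1, ∀ r ∈ Icc (0 : ℝ) 1, E p s = E q r → p = q ∧ s = r := by
    rintro ⟨i, k⟩ ⟨j, l⟩ s hs r hr he
    have he' := congrArg φ he
    simp only [hEdef, hσdef, hφψ] at he'
    have h1 := hmem' i k s hs
    have h2 := hmem j l r hr
    obtain ⟨rfl, h3⟩ := hh.inj i j _ ⟨(htn i k).trans_lt h1.1, h1.2.trans (htlt i (k + 1))⟩ _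
      ⟨(htn j l).trans h2.1, h2.2.trans (htlt j (l + 1)).le⟩ he'
    rw [← h3] at h2
    have hkl : k < l + 1 := (htmono i).lt_iff_lt.mp (h1.1.trans_le h2.2)
    have hlk : l < k + 1 := (htmono i).lt_iff_lt.mp (h2.1.trans_lt h1.2)
    obtain rfl : k = l := by omega
    exact ⟨rfl, mul_left_cancel₀ (hl i k).ne' (add_left_cancel h3)⟩
  have hopen : ∀ p, IsOpen (E p '' Ioo 0 1) := by
    rintro ⟨i, k⟩
    -- Over `D` the section recovers every point, so the interior of the arc is a full preimage of
    -- an open segment.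
    have : E (i, k) '' Ioo 0 1 = φ ⁻¹' (h i '' Ioo (t i k) (t i (k + 1))) := by
      ext x
      constructor
      · rintro ⟨s, hs, rfl⟩
        exact ⟨_, hmem' i k s hs, (hφψ _).symm⟩
      · rintro ⟨r, ⟨hr1, hr2⟩, hx⟩
        have hxD : φ x ∈ D := hx ▸ hD i r
          ⟨(htn i k).trans hr1.le, hr2.trans (htlt i (k + 1))⟩
        refine ⟨(r - t i k) / (t i (k + 1) - t i k), ⟨div_pos (by linarith) (hl i k),
          (div_lt_one (hl i k)).mpr (by linarith)⟩, ?_⟩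
        have : t i k + (t i (k + 1) - t i k) * ((r - t i k) / (t i (k + 1) - t i k)) = r := by
          rw [mul_div_cancel₀ _ (hl i k).ne']; ring
        simp only [hEdef, hσdef]
        rw [this, hx, hψφ x hxD]
    rw [this]
    exact (hh.isOpen_image i (htn i k) (htlt i (k + 1)).le).preimage hφ
  have hcov : ∀ i, σ i '' Ico 0 1 ⊆ ⋃ p, E p '' Icc 0 1 := by
    rintro i _ ⟨s, hs, rfl⟩
    obtain ⟨k, hk1, hk2⟩ := exists_mem_Ico_of_partition (ht0 i) (httop i) hs
    refine mem_iUnion.mpr ⟨(i, k), (s - t i k) / (t i (k + 1) - t i k),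
      ⟨div_nonneg (by linarith) (hl i k).le, (div_le_one (hl i k)).mpr (by linarith)⟩, ?_⟩
    simp only [hEdef]
    rw [mul_div_cancel₀ _ (hl i k).ne']
    congr 1; ring
  have hEdense : Dense (⋃ p, E p '' Icc 0 1) := by
    refine dense_closure.mp (hdense.mono fun x hx => ?_)
    obtain ⟨i, s, hs, hsx⟩ := hh.cover (φ x)
    have hx' : σ i s = x := by simp only [hσdef, hsx]; exact hψφ x hx
    rw [← hx']
    rcases hs.2.eq_or_lt with rfl | h1
    -- The arcs omit parameter 1; if its value lies in `D`, the lift is continuous there and the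
    -- point is a limit of arc points.
    · have hc := (hσ1 i (hsx ▸ hx) 1 hone).mono Ico_subset_Icc_self
      refine closure_mono (hcov i) (hc.mem_closure_image ?_)
      rw [closure_Ico zero_ne_one]
      exact hone
    · exact subset_closure (hcov i ⟨s, ⟨hs.1, h1⟩, rfl⟩)
  have hrefl : ∀ i, ∃ p, IsRoute E p (σ i 0) (σ i 0) := fun i =>
    ⟨_, hstart i ▸ (hself (i, 0)).concat (hself (i, 0)).rev⟩
  have hend : ∀ i, ∀ s ∈ Icc (0 : ℝ) 1, s ∉ Ioo (0 : ℝ) 1 → h i s ∈ D →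
      ∃ p, IsRoute E p (σ i 0) (σ i s) := by
    intro i s hs hs' hsD
    rcases hs.1.eq_or_lt with rfl | h0
    · exact hrefl i
    · obtain rfl : s = 1 := le_antisymm hs.2 (not_lt.mp fun h1 => hs' ⟨h0, h1⟩)
      exact ⟨σ i, hσ1 i hsD, rfl, rfl, stretches_of_partition (ht0 i) (htmono i) (httop i)
        (htgap i) (fun k => (i, k)) fun _ _ => rfl⟩
  -- Otherwise the edges reachable from `i` and the remaining ones form two closed sets covering
  -- `D`. Connectedness gives a common point in `D`, necessarily an endpoint of an edge of each
  -- kind, and a route passes through its lift.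
  have hjoin : ∀ i j, ∃ p, IsRoute E p (σ i 0) (σ j 0) := by
    intro i
    set C : Set H := {j | ∃ p, IsRoute E p (σ i 0) (σ j 0)} with hC
    by_contra! hno
    obtain ⟨j, hj⟩ := hno
    have hcl : ∀ B : Set H, IsClosed (⋃ j ∈ B, h j '' Icc 0 1) := fun B =>
      (toFinite B).isClosed_biUnion fun j _ => hh.isClosed_image j le_rfl le_rfl
    have hD0 : ∀ j, h j 0 ∈ D := fun j => hD j 0 ⟨le_rfl, one_pos⟩
    obtain ⟨y, hyD, hyC, hyC'⟩ := isPreconnected_closed_iff.mp hconn _ _ (hcl C) (hcl Cᶜ)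
      (by
        intro y _
        obtain ⟨k, s, hs, rfl⟩ := hh.cover y
        by_cases hk : k ∈ C
        · exact Or.inl (mem_biUnion hk ⟨s, hs, rfl⟩)
        · exact Or.inr (mem_biUnion (show k ∈ Cᶜ from hk) ⟨s, hs, rfl⟩))
      ⟨h i 0, hD0 i, mem_biUnion (show i ∈ C from hrefl i) ⟨0, hzero, rfl⟩⟩
      ⟨h j 0, hD0 j, mem_biUnion (show j ∈ Cᶜ from fun ⟨p, hp⟩ => hj p hp) ⟨0, hzero, rfl⟩⟩
    obtain ⟨k, hk, s, hs, rfl⟩ := mem_iUnion₂.mp hyC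
    obtain ⟨l, hl', r, hr, he⟩ := mem_iUnion₂.mp hyC'
    have hs' : s ∉ Ioo (0 : ℝ) 1 := fun hs' =>
      hl' ((hh.inj k l s hs' r hr he.symm).1 ▸ hk)
    have hr' : r ∉ Ioo (0 : ℝ) 1 := fun hr' =>
      hl' ((hh.inj l k r hr' s hs he).1 ▸ hk)
    obtain ⟨p, hp⟩ := hk
    obtain ⟨q, hq⟩ := hend k s hs hs' hyD
    obtain ⟨q', hq'⟩ := hend l r hr hr' (he ▸ hyD)
    have hlr : σ l r = σ k s := congrArg ψ he
    rw [hlr] at hq'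
    exact hl' ⟨_, (hp.concat hq).concat hq'.rev⟩
  have hhub : ∀ i, ∃ p, IsRoute E p (E (i, 0) 0) (E (i, 0) 0) ∧
      ∀ j, E (j, 0) '' Icc 0 1 ⊆ p '' Icc 0 1 := by
    intro i
    have hfin : ∀ B : Finset H, ∃ p, IsRoute E p (σ i 0) (σ i 0) ∧
        ∀ j ∈ B, E (j, 0) '' Icc 0 1 ⊆ p '' Icc 0 1 := by
      classical
      intro B
      induction B using Finset.induction_on with
      | empty => exact (hrefl i).imp fun p hp => ⟨hp, by simp⟩
      | insert j B _ ih =>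
        obtain ⟨p, hp, hpB⟩ := ih
        obtain ⟨q, hq⟩ := hjoin i j
        have hjE := hself (j, 0)
        rw [hstart] at hjE
        have hqj := hq.concat hjE
        have hloop := hqj.concat hqj.rev
        refine ⟨_, hp.concat hloop, fun l hl' => ?_⟩
        rcases Finset.mem_insert.mp hl' with rfl | hl'
        · exact (range_right_subset_concat (hq.target.trans hjE.source.symm)).trans
            (range_left_subset_concat.trans
              (range_right_subset_concat (hp.target.trans hloop.source.symm)))
        · exact (hpB l hl').trans range_left_subset_concat
    cases nonempty_fintype H
    obtain ⟨p, hp, hpB⟩ := hfin Finset.univ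
    exact ⟨p, by rwa [hstart], fun j => hpB j (Finset.mem_univ j)⟩
  have hleft : ∀ p : H × ℕ, ∃ l, IsRoute E l (E p 0) (E p 0) ∧
      (p.2 = 0 → ∀ j, E (j, 0) '' Icc 0 1 ⊆ l '' Icc 0 1) ∧
      ∀ k, p.2 = k + 1 → l '' Icc 0 1 = E (p.1, k) '' Icc 0 1 := by
    rintro ⟨i, _ | k⟩
    · obtain ⟨p, hp, hp'⟩ := hhub i
      exact ⟨p, hp, fun _ => hp', by simp⟩
    · have hk := hself (i, k)
      rw [hE01] at hk
      refine ⟨_, hk.rev.concat hk, by simp, fun k' hk' => ?_⟩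
      obtain rfl : k = k' := by simpa using hk'
      refine Subset.antisymm ?_ (range_right_subset_concat (hk.rev.target.trans hk.source.symm))
      refine (concat_range_subset (hk.rev.target.trans hk.source.symm)).trans ?_
      rw [rev_range, union_self]
  have hright : ∀ p : H × ℕ, ∃ r, IsRoute E r (E p 1) (E p 1) ∧
      r '' Icc 0 1 = E (p.1, p.2 + 1) '' Icc 0 1 := by
    rintro ⟨i, k⟩
    have hk := hself (i, k + 1)
    rw [← hE01] at hk
    refine ⟨_, hk.concat hk.rev, ?_⟩
    refine Subset.antisymm ?_ range_left_subset_concat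
    refine (concat_range_subset (hk.target.trans hk.rev.source.symm)).trans ?_
    rw [rev_range, union_self]
  choose l hlr hlhub hlprev using hleft
  choose r hrr hrnext using hright
  -- A loop at the left end, the arc itself, and a loop at the right end; the last is repeated only
  -- to make up four quarters.
  set w : H × ℕ → ℝ → X := fun p => concat (concat (l p) (E p)) (concat (r p) (r p)) with hwdef
  have hlE := fun p => (hlr p).concat (hself p)
  have hrr2 := fun p => (hrr p).concat (hrr p)
  have hroute : ∀ p, IsRoute E (w p) (E p 0) (E p 1) := fun p => (hlE p).concat (hrr2 p)
  have hwl : ∀ p, l p '' Icc 0 1 ⊆ w p '' Icc 0 1 := fun p =>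
    range_left_subset_concat.trans range_left_subset_concat
  have hwE : ∀ p, E p '' Icc 0 1 ⊆ w p '' Icc 0 1 := fun p =>
    (range_right_subset_concat (hlr p).target).trans range_left_subset_concat
  have hwr : ∀ p, r p '' Icc 0 1 ⊆ w p '' Icc 0 1 := fun p =>
    range_left_subset_concat.trans
      (range_right_subset_concat ((hlE p).target.trans (hrr2 p).source.symm))
  have hwsub : ∀ p, w p '' Icc 0 1 ⊆ (l p '' Icc 0 1 ∪ E p '' Icc 0 1) ∪ r p '' Icc 0 1 := by
    intro p
    refine (concat_range_subset ((hlE p).target.trans (hrr2 p).source.symm)).trans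
      (union_subset_union (concat_range_subset (hlr p).target) ?_)
    refine (concat_range_subset ((hrr p).target.trans (hrr p).source.symm)).trans ?_
    rw [union_self]
  have hsmall : ∀ ε > 0, {p | ∃ s ∈ Icc (0 : ℝ) 1, ε ≤ dist (w p s) (E p s)}.Finite := by
    intro ε hε
    have hK : ∀ i, ∃ K, ∀ k ≥ K, η i k < ε / 2 := fun i =>
      Filter.eventually_atTop.mp ((hη i).eventually (gt_mem_nhds (half_pos hε)))
    choose K hK using hK
    -- For `k > K i` the path stays in the arc and its two neighbours, so two diameters below `ε /
    -- 2` bound the displacement. The hub loops occur only at `k = 0`.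
    refine (finite_iUnion fun i => (finite_Iic (K i)).image (Prod.mk i)).subset ?_
    rintro ⟨i, k⟩ ⟨s, hs, hle⟩
    refine mem_iUnion.mpr ⟨i, k, ?_, rfl⟩
    by_contra hk
    rw [mem_Iic, not_le] at hk
    obtain ⟨k, rfl⟩ := Nat.exists_eq_succ_of_ne_zero (Nat.ne_zero_of_lt hk)
    refine absurd hle (not_le.mpr ?_)
    have hEs : E (i, k + 1) s ∈ E (i, k + 1) '' Icc 0 1 := mem_image_of_mem _ hs
    have h0 := hK i k (by omega)
    have h1 := hK i (k + 1) (by omega)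
    have h2 := hK i (k + 1 + 1) (by omega)
    rcases hwsub _ (mem_image_of_mem (w (i, k + 1)) hs) with (hm | hm) | hm
    · rw [hlprev _ k rfl] at hm
      have d1 := hpiece i k _ hm _ (mem_image_of_mem _ hone)
      rw [hE01] at d1
      have d2 := hpiece i (k + 1) _ (mem_image_of_mem _ hzero) _ hEs
      exact (dist_triangle _ _ _).trans_lt (by linarith : _ < ε)
    · linarith [hpiece i (k + 1) _ hm _ hEs, @dist_nonneg X _ (w (i, k + 1) s) (E (i, k + 1) s)]
    · rw [hrnext] at hm
      have d1 := hpiece i (k + 1 + 1) _ hm _ (mem_image_of_mem _ hzero)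
      rw [← hE01] at d1
      have d2 := hpiece i (k + 1) _ (mem_image_of_mem _ hone) _ hEs
      exact (dist_triangle _ _ _).trans_lt (by linarith : _ < ε)
  have hup : ∀ i k, Relation.ReflTransGen
      (fun p q => E q '' Icc 0 1 ⊆ w p '' Icc 0 1) (i, 0) (i, k) := by
    intro i k
    induction k with
    | zero => exact .refl
    | succ k ih => exact ih.tail (by rw [← hrnext (i, k)]; exact hwr _)
  have hdown : ∀ i k, Relation.ReflTransGen
      (fun p q => E q '' Icc 0 1 ⊆ w p '' Icc 0 1) (i, k) (i, 0) := by
    intro i k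
    induction k with
    | zero => exact .refl
    | succ k ih => exact .head (by rw [← hlprev (i, k + 1) k rfl]; exact hwl _) ih
  have hwalk0 : ∀ p, w p 0 = E p 0 := fun p => (hroute p).source
  have hwalk1 : ∀ p, w p 1 = E p 1 := fun p => (hroute p).target
  refine ⟨arcMap E w, continuous_arcMap hEc hinj hopen (fun p => (hroute p).continuousOn)
    hwalk0 hwalk1 hsmall, isTopologicallyMixing_arcMap hEc hinj hEdense hwalk0 hwalk1
    (fun p => (hlr p).stretches_two (hself p) (hrr p) (hrr p)) hwE ?_⟩
  rintro ⟨i, k⟩ ⟨j, k'⟩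
  -- Descend to the first arc of edge `i`, jump to that of edge `j` through the hub loop, then
  -- climb.
  exact ((hdown i k).tail ((hlhub (i, 0) rfl j).trans (hwl _))).trans (hup j k')

/-! ### From tranched graphs to the section over `D` -/

lemma IsArcwiseConnected.isPreconnected {X : Type*} [TopologicalSpace X] {S : Set X}
    (hS : IsArcwiseConnected S) : IsPreconnected S := by
  refine isPreconnected_of_forall_pair fun x hx y hy => ?_
  by_cases hxy : x = y
  · subst hxy
    exact ⟨{x}, singleton_subset_iff.mpr hx, rfl, rfl, isPreconnected_singleton⟩
  · obtain ⟨A, ⟨γ, hγ, rfl, h0, h1⟩, hA⟩ := hS x hx y hy hxy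
    exact ⟨range γ, hA, ⟨0, h0⟩, ⟨1, h1⟩, isPreconnected_range hγ.continuous⟩

/-- A right inverse of a closed map is continuous on the set of degenerate values. -/
lemma continuousOn_degenerateValues {X Y : Type*} [TopologicalSpace X] [TopologicalSpace Y]
    {φ : X → Y} {ψ : Y → X} (hφ : IsClosedMap φ) (hφψ : ∀ y, φ (ψ y) = y) :
    ContinuousOn ψ (degenerateValues φ) := by
  rw [continuousOn_iff_isClosed]
  intro C hC
  -- Over a degenerate value the fiber is one point, so meeting `C` and having `ψ y` in `C` are the
  -- same.
  refine ⟨φ '' C, hφ C hC, ?_⟩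
  ext y
  refine and_congr_left ?_
  rintro ⟨x, hx⟩
  have hu : ∀ z, φ z = y → z = x := fun z hz => hx.subset hz
  constructor
  · exact fun h => ⟨ψ y, h, hφψ y⟩
  · rintro ⟨z, hz, hzy⟩
    rwa [mem_preimage, hu _ (hφψ y), ← hu z hzy]

theorem mainTheorem11 {X : Type*} {Y : Type*} [TopologicalSpace X] [TopologicalSpace Y]
    (φ : X → Y) (hφ : IsTranchedGraphMap φ)
    (harc : IsArcwiseConnected {x : X | φ ⁻¹' {φ x} = {x}}) :
    ∃ f : X → X, Continuous f ∧ IsTopologicallyMixing f := by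
  have := hφ.continuum.compact
  have := hφ.continuum.metrizable
  have := hφ.graph.1
  let _ : MetricSpace X := TopologicalSpace.metrizableSpaceMetric X
  have hS : {x : X | φ ⁻¹' {φ x} = {x}} = φ ⁻¹' degenerateValues φ := by
    ext x
    refine ⟨fun hx => ⟨x, hx⟩, ?_⟩
    rintro ⟨z, hz⟩
    have hxz : x = z := hz.subset rfl
    exact hxz ▸ hz
  have hsurj : Function.Surjective φ := fun y => (hφ.monotone y).nonempty
  obtain ⟨ψ, hφψ⟩ := hsurj.hasRightInverse
  have hψφ : ∀ x, φ x ∈ degenerateValues φ → ψ (φ x) = x := by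
    intro x hx
    have hx' : φ ⁻¹' {φ x} = {x} := (Set.ext_iff.mp hS x).mpr hx
    exact hx'.subset (hφψ (φ x))
  have himg : φ '' (φ ⁻¹' degenerateValues φ) = degenerateValues φ :=
    image_preimage_eq _ hsurj
  have hconn : IsPreconnected (degenerateValues φ) := by
    rw [← himg, ← hS]
    exact harc.isPreconnected.image φ hφ.continuous.continuousOn
  have hdense : Dense (degenerateValues φ) :=
    himg ▸ hsurj.denseRange.dense_image hφ.continuous hφ.dense
  obtain ⟨H, _, h, hh, hD⟩ := hφ.graph.exists_isEdgeSystem_subset hdense hconn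
  exact exists_mixing_of_isEdgeSystem hφ.continuous hφψ hψφ
    (continuousOn_degenerateValues hφ.continuous.isClosedMap hφψ) hφ.dense hconn hh hD
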